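/- Let $K$ be a field of characteristic $0$, let $n\ge 1$, and let $K(q)$ be the field of rational functions over $K$ in variables $q_1,\dots,q_n$ subject to the single relation $q_1q_2\cdots q_n=1$, i.e. the fraction field of the integral domain $K[q_1,\dots,q_n]/(q_1\cdots q_n-1)$. The symmetric group $S_n$ acts on $K(q)$ from the left by $\sigma[f(q_1,\dots,q_n)]=f(q_{\sigma(1)},\dots,q_{\sigma(n)})$. Let $K(q)S_n$ be the $K(q)$-vector space with basis $S_n$, equipped with the (associative) twisted product $$f\sigma\ltimes g\tau=\bigl(f\cdot\sigma[g]\bigr)\,\sigma\tau\qquad(f,g\in K(q),\ \sigma,\tau\in S_n),$$ where $\sigma\tau$ is composition from right to left. For $\sigma\in S_n$ let $D(\sigma)=\{\,j: 1\le j\le n-1,\ \sigma(j)>\sigma(j+1)\}$ and $$\mathrm{maj}_q(\sigma)=\frac{\prod_{j\in D(\sigma)}q_{\sigma(1)}q_{\sigma(2)}\cdots q_{\sigma(j)}}{\prod_{i=1}^{n-1}\bigl(1-q_{\sigma(1)}q_{\sigma(2)}\cdots q_{\sigma(i)}\bigr)}\in K(q).$$ Let $\gamma=(1,2,\dots,n)$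 be the $n$-cycle $i\mapsto i+1$, and put $$e_n(q)=\sum_{\sigma\in S_n}\mathrm{maj}_q(\sigma)\,\sigma,\qquad \theta_n(q)=\sum_{i=0}^{n-1}\mathrm{maj}_q(\gamma^i)\,\gamma^i .$$ Identify $\sigma\in S_n$ with the word $\sigma(1)\sigma(2)\cdots\sigma(n)$ in the free associative $K(q)$-algebra on the letters $1,\dots,n$, and let $\mathcal L_n(q)$ be the set of elements of $K(q)S_n$ that lie in the smallest $K(q)$-subspace of this free algebra that contains the letters and is closed under the bracket $[a,b]=ab-ba$. Then: 1. The left ideal $K(q)S_n\ltimes e_n(q)$ is equal to $\mathcal L_n(q)$. 2. $\dim_{K(q)}\mathcal L_n(q)=(n-1)!$. 3. The map $x\mapsto x\ltimes\theta_n(q)$ is a bijection from $K(q)S_n\ltimes e_n(q)$ onto the left ideal $K(q)S_n\ltimes\theta_n(q)$, with inverse $y\mapsto y\ltimes e_n(q)$. 4. The elements $\sigma\ltimes\theta_n(q)$, for $\sigma\in S_n$ with $\sigma(1)=1$, form a basis of $K(q)S_n\ltimes\theta_n(q)$ over $K(q)$; in particular they are pairwise distinct. -/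

import Mathlib

open scoped BigOperators

namespace QKlyachko

universe u

attribute [local instance] LieRing.ofAssociativeRing

/-! ### The field `K(q)` of rational functions in `q₁, …, qₙ` subject to `q₁ ⋯ qₙ = 1` -/

/-- The ideal generated by the relation `q₁ q₂ ⋯ qₙ - 1` in the polynomial ring. -/
noncomputable def relIdeal (K : Type u) [Field K] (n : ℕ) : Ideal (MvPolynomial (Fin n) K) :=
  Ideal.span {(∏ i : Fin n, MvPolynomial.X i) - 1}

theorem relIdeal_isPrime (K : Type u) [Field K] (n : ℕ) : (relIdeal K n).IsPrime := by
  cases n with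
  | zero =>
    have h : relIdeal K 0 = ⊥ := by simp [relIdeal]
    rw [h]
    exact Ideal.isPrime_bot
  | succ m =>
    have ha : (∏ i : Fin m, (MvPolynomial.X i : MvPolynomial (Fin m) K)) ≠ 0 :=
      Finset.prod_ne_zero_iff.mpr fun i _ => MvPolynomial.X_ne_zero i
    have himg : MvPolynomial.finSuccEquiv K m
        ((∏ i : Fin (m + 1), MvPolynomial.X i) - 1) =
        Polynomial.C (∏ i : Fin m, (MvPolynomial.X i : MvPolynomial (Fin m) K)) *
          Polynomial.X + Polynomial.C (-1) := by
      rw [Fin.prod_univ_succ, map_sub, map_mul, map_prod, map_one,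
        MvPolynomial.finSuccEquiv_X_zero]
      simp only [MvPolynomial.finSuccEquiv_X_succ]
      rw [← map_prod, Polynomial.C_neg, map_one]
      ring
    have hirr : Irreducible (MvPolynomial.finSuccEquiv K m
        ((∏ i : Fin (m + 1), MvPolynomial.X i) - 1)) := by
      rw [himg]
      refine Polynomial.irreducible_of_degree_eq_one_of_isRelPrime_coeff
        (Polynomial.degree_linear ha) ?_
      have h0 : (Polynomial.C (∏ i : Fin m, (MvPolynomial.X i : MvPolynomial (Fin m) K)) *
          Polynomial.X + Polynomial.C (-1)).coeff 0 = -1 := by simp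
      rw [h0]
      exact isRelPrime_one_left.neg_left
    have hirr' : Irreducible
        ((∏ i : Fin (m + 1), (MvPolynomial.X i : MvPolynomial (Fin (m + 1)) K)) - 1) :=
      (MulEquiv.irreducible_iff (MvPolynomial.finSuccEquiv K m)).mp hirr
    exact (Ideal.span_singleton_prime hirr'.ne_zero).mpr hirr'.prime

/-- The coordinate ring `K[q₁, …, qₙ] / (q₁ ⋯ qₙ - 1)`. -/
abbrev CoordRing (K : Type u) [Field K] (n : ℕ) : Type u :=
  MvPolynomial (Fin n) K ⧸ relIdeal K n

instance instIsDomainCoordRing (K : Type u) [Field K] (n : ℕ) : IsDomain (CoordRing K n) :=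
  (Ideal.Quotient.isDomain_iff_prime _).mpr (relIdeal_isPrime K n)

/-- The field `K(q)`: the fraction field of `K[q₁, …, qₙ] / (q₁ ⋯ qₙ - 1)`. -/
def RatField (K : Type u) [Field K] (n : ℕ) : Type u := FractionRing (CoordRing K n)

noncomputable instance instFieldRatField (K : Type u) [Field K] (n : ℕ) : Field (RatField K n) :=
  inferInstanceAs (Field (FractionRing (CoordRing K n)))

noncomputable instance instAlgebraRatField (K : Type u) [Field K] (n : ℕ) :
    Algebra (CoordRing K n) (RatField K n) :=
  inferInstanceAs (Algebra (CoordRing K n) (FractionRing (CoordRing K n)))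

instance instIsFractionRingRatField (K : Type u) [Field K] (n : ℕ) :
    IsFractionRing (CoordRing K n) (RatField K n) :=
  inferInstanceAs (IsFractionRing (CoordRing K n) (FractionRing (CoordRing K n)))

/-- The variable `q_{i+1}` as an element of `K(q)` (indices are shifted: `i = 0, …, n-1`). -/
noncomputable def q (K : Type u) [Field K] {n : ℕ} (i : Fin n) : RatField K n :=
  algebraMap (CoordRing K n) (RatField K n) (Ideal.Quotient.mk (relIdeal K n) (MvPolynomial.X i))

theorem prod_q (K : Type u) [Field K] (n : ℕ) : ∏ i : Fin n, q K i = 1 := by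
  have h : Ideal.Quotient.mk (relIdeal K n) (∏ i : Fin n, MvPolynomial.X i) =
      Ideal.Quotient.mk (relIdeal K n) 1 :=
    Ideal.Quotient.eq.mpr (Ideal.subset_span (Set.mem_singleton _))
  simp only [q]
  rw [← map_prod, ← map_prod, h, map_one, map_one]

/-! ### The left action of `Sₙ`: `σ • f(q₁, …, qₙ) = f(q_{σ(1)}, …, q_{σ(n)})` -/

theorem rename_mem_relIdeal (K : Type u) [Field K] {n : ℕ} (σ : Equiv.Perm (Fin n)) :
    relIdeal K n ≤ (relIdeal K n).comap
      (MvPolynomial.rename σ : MvPolynomial (Fin n) K →ₐ[K] MvPolynomial (Fin n) K) := by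
  rw [relIdeal, Ideal.span_le, Set.singleton_subset_iff]
  have h : MvPolynomial.rename σ
      ((∏ i : Fin n, (MvPolynomial.X i : MvPolynomial (Fin n) K)) - 1) =
      (∏ i : Fin n, MvPolynomial.X i) - 1 := by
    rw [map_sub, map_one, map_prod]
    simp only [MvPolynomial.rename_X]
    rw [Equiv.prod_comp σ (fun i => (MvPolynomial.X i : MvPolynomial (Fin n) K))]
  have hm : MvPolynomial.rename σ
      ((∏ i : Fin n, (MvPolynomial.X i : MvPolynomial (Fin n) K)) - 1) ∈
      Ideal.span {(∏ i : Fin n, (MvPolynomial.X i : MvPolynomial (Fin n) K)) - 1} := by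
    rw [h]
    exact Ideal.subset_span (Set.mem_singleton _)
  exact hm

/-- The substitution `q_i ↦ q_{σ(i)}` on the coordinate ring. -/
noncomputable def permHom (K : Type u) [Field K] {n : ℕ} (σ : Equiv.Perm (Fin n)) :
    CoordRing K n →ₐ[K] CoordRing K n :=
  Ideal.quotientMapₐ (relIdeal K n) (MvPolynomial.rename σ) (rename_mem_relIdeal K σ)

theorem permHom_mk (K : Type u) [Field K] {n : ℕ} (σ : Equiv.Perm (Fin n))
    (p : MvPolynomial (Fin n) K) :
    permHom K σ (Ideal.Quotient.mk (relIdeal K n) p) =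
      Ideal.Quotient.mk (relIdeal K n) (MvPolynomial.rename σ p) := rfl

noncomputable instance instActionCoordRing (K : Type u) [Field K] (n : ℕ) :
    MulSemiringAction (Equiv.Perm (Fin n)) (CoordRing K n) where
  smul σ x := permHom K σ x
  one_smul x := by
    obtain ⟨p, rfl⟩ := Ideal.Quotient.mk_surjective x
    change permHom K 1 _ = _
    rw [permHom_mk, Equiv.Perm.coe_one, MvPolynomial.rename_id_apply]
  mul_smul σ τ x := by
    obtain ⟨p, rfl⟩ := Ideal.Quotient.mk_surjective x
    change permHom K (σ * τ) _ = permHom K σ (permHom K τ _)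
    rw [permHom_mk, permHom_mk, permHom_mk, MvPolynomial.rename_rename, Equiv.Perm.coe_mul]
  smul_zero σ := map_zero (permHom K σ)
  smul_add σ := map_add (permHom K σ)
  smul_one σ := map_one (permHom K σ)
  smul_mul σ := map_mul (permHom K σ)

/-- The action on `K(q)`, extended from the coordinate ring to fractions. -/
noncomputable instance instActionRatField (K : Type u) [Field K] (n : ℕ) :
    MulSemiringAction (Equiv.Perm (Fin n)) (RatField K n) :=
  IsFractionRing.mulSemiringAction (Equiv.Perm (Fin n)) (CoordRing K n) (RatField K n)

theorem smul_q (K : Type u) [Field K] {n : ℕ} (σ : Equiv.Perm (Fin n)) (i : Fin n) :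
    σ • q K i = q K (σ i) := by
  have h : σ • q K i = algebraMap (CoordRing K n) (RatField K n)
      (permHom K σ (Ideal.Quotient.mk (relIdeal K n) (MvPolynomial.X i))) :=
    IsFractionRing.ringEquivOfRingEquiv_algebraMap
      (MulSemiringAction.toRingEquiv (Equiv.Perm (Fin n)) (CoordRing K n) σ) _
  rw [h, permHom_mk, MvPolynomial.rename_X]
  rfl

/-! ### The twisted group algebra, Lie elements, and the elements `eₙ(q)` and `θₙ(q)` -/

/-- `K(q)Sₙ` with the twisted product `f σ ⋉ g τ = (f · σ[g]) στ`. -/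
abbrev TwistedAlg (K : Type u) [Field K] (n : ℕ) : Type u :=
  SkewMonoidAlgebra (RatField K n) (Equiv.Perm (Fin n))

theorem single_mul_single_twisted (K : Type u) [Field K] {n : ℕ} (f g : RatField K n)
    (σ τ : Equiv.Perm (Fin n)) :
    (SkewMonoidAlgebra.single σ f * SkewMonoidAlgebra.single τ g : TwistedAlg K n) =
      SkewMonoidAlgebra.single (σ * τ) (f * σ • g) :=
  SkewMonoidAlgebra.single_mul_single

/-- The word `σ(1) σ(2) ⋯ σ(n)` in the free associative algebra on `{1, …, n}`. -/
noncomputable def word (K : Type u) [Field K] {n : ℕ} (σ : Equiv.Perm (Fin n)) :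
    FreeAlgebra (RatField K n) (Fin n) :=
  (List.ofFn fun i : Fin n => FreeAlgebra.ι (RatField K n) (σ i)).prod

/-- The `K(q)`-linear inclusion of `K(q)Sₙ` in the free associative algebra, `σ ↦ σ(1) ⋯ σ(n)`. -/
noncomputable def toWords (K : Type u) [Field K] (n : ℕ) :
    TwistedAlg K n →ₗ[RatField K n] FreeAlgebra (RatField K n) (Fin n) :=
  Finsupp.linearCombination (RatField K n) (word K) ∘ₗ
    (SkewMonoidAlgebra.coeffLinearEquiv (S := RatField K n)).toLinearMap

/-- The smallest subspace of the free associative algebra over `K(q)` on `{1, …, n}` that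
contains the letters and is closed under the bracket `[a, b] = ab - ba`. -/
noncomputable def freeLie (K : Type u) [Field K] (n : ℕ) :
    LieSubalgebra (RatField K n) (FreeAlgebra (RatField K n) (Fin n)) :=
  LieSubalgebra.lieSpan (RatField K n) (FreeAlgebra (RatField K n) (Fin n))
    (Set.range (FreeAlgebra.ι (RatField K n)))

/-- `Lₙ(q)`: the elements of `K(q)Sₙ` that are Lie elements of the free associative algebra. -/
noncomputable def lieElements (K : Type u) [Field K] (n : ℕ) :
    Submodule (RatField K n) (TwistedAlg K n) :=
  (freeLie K n).toSubmodule.comap (toWords K n)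

/-- The descent set `{j : 1 ≤ j ≤ n - 1, σ(j) > σ(j+1)}`, where the `j`-th letter `σ(j)` is
`σ ⟨j - 1, _⟩` in the zero-based indexing of `Fin n`. -/
def descentSet {n : ℕ} (σ : Equiv.Perm (Fin n)) : Finset ℕ :=
  (Finset.Ico 1 n).filter fun j =>
    ∃ h : j < n, σ ⟨j, h⟩ < σ ⟨j - 1, lt_of_le_of_lt (Nat.sub_le j 1) h⟩

/-- `q_{σ(1)} q_{σ(2)} ⋯ q_{σ(j)}`. -/
noncomputable def prefixProd (K : Type u) [Field K] {n : ℕ} (σ : Equiv.Perm (Fin n)) (j : ℕ) :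
    RatField K n :=
  ∏ i : Fin n with i.val < j, q K (σ i)

/-- The `q`-major index of `σ`. -/
noncomputable def qMaj (K : Type u) [Field K] {n : ℕ} (σ : Equiv.Perm (Fin n)) : RatField K n :=
  (∏ j ∈ descentSet σ, prefixProd K σ j) / ∏ i ∈ Finset.Ico 1 n, (1 - prefixProd K σ i)

/-- `eₙ(q) = ∑_σ maj_q(σ) σ`. -/
noncomputable def e (K : Type u) [Field K] (n : ℕ) : TwistedAlg K n :=
  ∑ σ : Equiv.Perm (Fin n), SkewMonoidAlgebra.single σ (qMaj K σ)

/-- `θₙ(q) = ∑_{i=0}^{n-1} maj_q(γ^i) γ^i`, where `γ` is the `n`-cycle `(1, 2, …, n)`. -/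
noncomputable def theta (K : Type u) [Field K] (n : ℕ) : TwistedAlg K n :=
  ∑ i ∈ Finset.range n, SkewMonoidAlgebra.single (finRotate n ^ i) (qMaj K (finRotate n ^ i))

end QKlyachko

namespace QKlyachko

universe u

attribute [local instance] LieRing.ofAssociativeRing

/-! ### Prefix products -/

section Prefix

variable {K : Type u} [Field K] {n : ℕ}

/-! Write `A` for the twisted algebra. Two identities and a dimension count carry the proof. (a)
Since `γ • maj_q(σ) = q₁ maj_q(γσ)`, both `e` and `θ` satisfy `γ ⋉ x = q₁ x`. For any such `x`, the
left ideal `A ⋉ x` is spanned by the `(n-1)!` elements `σ ⋉ x` with `σ(1) = 1` (`mul_mem_span`).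
Moreover `θ ⋉ x = x` (`theta_mul`), because `∑ᵢ maj_q(γⁱ) q₁⋯qᵢ = 1` by Lagrange interpolation; in
particular `θ ⋉ e = e`. (b) Every Lie element satisfies `x ⋉ e = x` (`mul_e_of_mem_lieElements`).
This follows from the shuffle relations on the coefficients of a Lie element, so `L ⊆ A ⋉ e`.
Left-normed brackets starting with the letter 1 give `dim L ≥ (n-1)!`, while `dim A ⋉ e ≤ (n-1)!`;
hence `L = A ⋉ e`. Finally `x ⋉ θ ⋉ e = x ⋉ e = x` on `L`, so right multiplication by `θ` is
injective there, and counting dimensions again gives the statements about `A ⋉ θ`. -/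

theorem smul_prefixProd (τ σ : Equiv.Perm (Fin n)) (j : ℕ) :
    τ • prefixProd K σ j = prefixProd K (τ * σ) j := by
  simp [prefixProd, Finset.smul_prod', smul_q]

theorem smul_div_ratField (τ : Equiv.Perm (Fin n)) (a b : RatField K n) :
    τ • (a / b) = τ • a / τ • b :=
  map_div₀ (MulSemiringAction.toRingHom (Equiv.Perm (Fin n)) (RatField K n) τ) a b

theorem prefixProd_zero (σ : Equiv.Perm (Fin n)) : prefixProd K σ 0 = 1 := by
  simp [prefixProd]

theorem prefixProd_of_le (σ : Equiv.Perm (Fin n)) {j : ℕ} (hj : n ≤ j) :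
    prefixProd K σ j = 1 := by
  have h : ∀ i : Fin n, i.val < j := fun i => i.isLt.trans_le hj
  rw [prefixProd, Finset.filter_true_of_mem fun i _ => h i, ← prod_q K n]
  exact Equiv.prod_comp σ (q K)

theorem prefixProd_succ (σ : Equiv.Perm (Fin n)) (i : Fin n) :
    prefixProd K σ (i + 1) = prefixProd K σ i * q K (σ i) := by
  have h : (Finset.univ.filter fun l : Fin n => l.val < i.val + 1) =
      insert i (Finset.univ.filter fun l : Fin n => l.val < i.val) := by
    ext l
    simp only [Finset.mem_filter, Finset.mem_univ, true_and, Finset.mem_insert, Fin.ext_iff]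
    omega
  rw [prefixProd, h, Finset.prod_insert (by simp), mul_comm]
  rfl

theorem q_ne_zero (i : Fin n) : q K i ≠ 0 := by
  have h : ∏ i : Fin n, q K i ≠ 0 := by simp [prod_q]
  exact Finset.prod_ne_zero_iff.mp h i (Finset.mem_univ i)

theorem prefixProd_ne_zero (σ : Equiv.Perm (Fin n)) (j : ℕ) : prefixProd K σ j ≠ 0 :=
  Finset.prod_ne_zero_iff.mpr fun _ _ => q_ne_zero _

/-- Pick `a ∈ S` and `b ∉ S`. The specialization `q_a = X`, `q_b = X⁻¹`, all other variables 1,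
respects the relation and sends the product to `X`. -/
theorem prod_q_ne_one (S : Finset (Fin n)) (hS : S.Nonempty) (hS' : Sᶜ.Nonempty) :
    ∏ i ∈ S, q K i ≠ 1 := by
  obtain ⟨a, ha⟩ := hS
  obtain ⟨b, hb⟩ := hS'
  rw [Finset.mem_compl] at hb
  have hab : a ≠ b := fun h => hb (h ▸ ha)
  let v : Fin n → RatFunc K := fun i =>
    (if i = a then RatFunc.X else 1) * (if i = b then RatFunc.X⁻¹ else 1)
  have hv : ∏ i, v i = 1 := by
    rw [Finset.prod_mul_distrib, Finset.prod_ite_eq', Finset.prod_ite_eq',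
      if_pos (Finset.mem_univ a), if_pos (Finset.mem_univ b), mul_inv_cancel₀ RatFunc.X_ne_zero]
  let f : CoordRing K n →+* RatFunc K := Ideal.Quotient.lift (relIdeal K n)
    (MvPolynomial.aeval v : MvPolynomial (Fin n) K →ₐ[K] RatFunc K).toRingHom (by
      intro p hp
      obtain ⟨r, rfl⟩ := Ideal.mem_span_singleton'.mp hp
      simp [hv])
  intro h
  have h1 : ∏ i ∈ S, (Ideal.Quotient.mk (relIdeal K n) (MvPolynomial.X i)) = 1 := by
    apply IsFractionRing.injective (CoordRing K n) (RatField K n)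
    rw [map_prod, map_one]
    exact h
  have h2 := congrArg f h1
  rw [map_prod, map_one] at h2
  have h3 : ∀ i, f (Ideal.Quotient.mk (relIdeal K n) (MvPolynomial.X i)) = v i := fun i => by
    simp [f]
  simp only [h3, v, Finset.prod_mul_distrib, Finset.prod_ite_eq', ha, hb, if_true, if_false,
    mul_one] at h2
  have h4 : (algebraMap (Polynomial K) (RatFunc K)) Polynomial.X =
      algebraMap (Polynomial K) (RatFunc K) 1 := by
    rw [RatFunc.algebraMap_X, h2, map_one]
  have h5 := congrArg Polynomial.natDegree (RatFunc.algebraMap_injective K h4)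
  simp at h5

theorem prefixProd_ne_one (σ : Equiv.Perm (Fin n)) {j : ℕ} (h1 : 1 ≤ j) (h2 : j < n) :
    prefixProd K σ j ≠ 1 := by
  have h : prefixProd K σ j =
      ∏ i ∈ (Finset.univ.filter fun i : Fin n => i.val < j).map σ.toEmbedding, q K i := by
    rw [Finset.prod_map]; rfl
  rw [h]
  refine prod_q_ne_one _ ⟨σ ⟨0, by omega⟩, ?_⟩ ⟨σ ⟨j, h2⟩, ?_⟩
  · simp; omega
  · simp

/-! ### The action of the long cycle on the `q`-major index -/

theorem finRotate_val (i : Fin n) :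
    (finRotate n i).val = if i.val + 1 = n then 0 else i.val + 1 := by
  cases n with
  | zero => exact i.elim0
  | succ m =>
    rw [coe_finRotate]
    simp [Fin.ext_iff]

theorem mem_descentSet (σ : Equiv.Perm (Fin n)) {j : ℕ} (h : j + 1 < n) :
    j + 1 ∈ descentSet σ ↔ σ ⟨j + 1, h⟩ < σ ⟨j, by omega⟩ := by
  simp [descentSet, h]

/-- The denominators correspond factor by factor. In the numerator, `γ` turns the largest letter, at
zero-based position `k`, into the smallest and preserves the order of the others: a descent just
after that letter becomes a descent just before it. The numerators thus differ by `P (k + 1) / P k`,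
which is the variable of the new smallest letter. -/
theorem finRotate_smul_qMaj [NeZero n] (σ : Equiv.Perm (Fin n)) :
    finRotate n • qMaj K σ = q K 0 * qMaj K (finRotate n * σ) := by
  set γ := finRotate n
  have hn : 0 < n := Nat.pos_of_neZero n
  let k : Fin n := σ.symm ⟨n - 1, by omega⟩
  have hk : (σ k).val = n - 1 := by simp [k]
  have hk' : ∀ i : Fin n, i ≠ k → (σ i).val ≠ n - 1 := by
    intro i hi h
    exact hi (σ.injective (Fin.ext (h.trans hk.symm)))
  have hγ : γ (σ k) = 0 := by
    apply Fin.ext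
    rw [finRotate_val, hk, if_pos (by omega)]
    rfl
  let P := prefixProd K (γ * σ)
  -- The range includes `0` and `n`, where `P` equals 1, so a largest letter in first or last
  -- position needs no separate treatment.
  have hterm : ∀ j ∈ Finset.range (n + 1),
      (if j ∈ descentSet σ then P j else 1) * (if j = k.val then P j else 1) =
      (if j ∈ descentSet (γ * σ) then P j else 1) * (if j = k.val + 1 then P j else 1) := by
    intro j hj
    have hP0 : P 0 = 1 := prefixProd_zero _
    have hPn : P n = 1 := prefixProd_of_le _ le_rfl
    rcases j with _ | j
    · simp [hP0]
    · rcases Nat.lt_or_ge (j + 1) n with hjn | hjn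
      · simp only [mem_descentSet _ hjn, Equiv.Perm.mul_apply, Fin.lt_def, γ, finRotate_val]
        have b1 := (σ ⟨j, by omega⟩).isLt
        have b2 := (σ ⟨j + 1, hjn⟩).isLt
        by_cases c1 : j + 1 = k.val
        · have e1 : (⟨j + 1, hjn⟩ : Fin n) = k := Fin.ext c1
          have h1 := hk' ⟨j, by omega⟩ (by rw [← e1]; simp)
          rw [e1, hk]
          rw [if_neg (by omega), if_pos c1, if_pos (by split_ifs <;> omega), if_neg (by omega)]
          ring
        · by_cases c2 : j = k.val
          · have e1 : (⟨j, by omega⟩ : Fin n) = k := Fin.ext c2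
            have h1 := hk' ⟨j + 1, hjn⟩ (by rw [← e1]; simp)
            rw [e1, hk]
            rw [if_pos (by omega), if_neg c1, if_neg (by split_ifs <;> omega),
              if_pos (by omega)]
            ring
          · have h1 := hk' ⟨j, by omega⟩ (fun h => c2 (congrArg Fin.val h))
            have h2 := hk' ⟨j + 1, hjn⟩ (fun h => c1 (congrArg Fin.val h))
            rw [if_neg (show ¬ ((σ ⟨j + 1, hjn⟩).val + 1 = n) by omega),
              if_neg (show ¬ ((σ ⟨j, by omega⟩).val + 1 = n) by omega), if_neg c1,
              if_neg (show ¬ (j + 1 = k.val + 1) by omega)]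
            simp
      · have hjn' : j + 1 = n := by
          have := Finset.mem_range.mp hj
          omega
        simp [hjn', hPn]
  have hprod := Finset.prod_congr rfl hterm
  have hD : ∀ τ : Equiv.Perm (Fin n),
      ∏ j ∈ Finset.range (n + 1), (if j ∈ descentSet τ then P j else 1) =
      ∏ j ∈ descentSet τ, P j := by
    intro τ
    rw [← Finset.prod_filter, Finset.filter_mem_eq_inter, Finset.inter_eq_right.mpr]
    intro j hj
    have := Finset.mem_Ico.mp (Finset.mem_filter.mp hj).1
    exact Finset.mem_range.mpr (by omega)
  rw [Finset.prod_mul_distrib, Finset.prod_mul_distrib, hD, hD, Finset.prod_ite_eq',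
    Finset.prod_ite_eq', if_pos (Finset.mem_range.mpr (by omega)),
    if_pos (Finset.mem_range.mpr (by omega))] at hprod
  have hPk : P (k.val + 1) = P k.val * q K 0 := by
    have := prefixProd_succ (K := K) (γ * σ) k
    rwa [Equiv.Perm.mul_apply, hγ] at this
  rw [hPk] at hprod
  have hne : P k.val ≠ 0 := prefixProd_ne_zero _ _
  have hnum : ∏ j ∈ descentSet σ, P j = q K 0 * ∏ j ∈ descentSet (γ * σ), P j := by
    apply mul_right_cancel₀ hne
    rw [hprod]; ring
  rw [qMaj, qMaj, smul_div_ratField, Finset.smul_prod', Finset.smul_prod']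
  simp only [smul_sub, smul_one, smul_prefixProd]
  rw [mul_div_assoc', ← hnum]

theorem descentSet_one : descentSet (1 : Equiv.Perm (Fin n)) = ∅ := by
  refine Finset.filter_eq_empty_iff.mpr ?_
  rintro j hj ⟨h, h'⟩
  simp only [Equiv.Perm.one_apply, Fin.lt_def] at h'
  omega

/-- The product `q₁ q₂ ⋯ q_k` with indices read cyclically. -/
noncomputable def cycProd (K : Type u) [Field K] (n : ℕ) [NeZero n] (k : ℕ) : RatField K n :=
  ∏ j ∈ Finset.range k, q K ((finRotate n ^ j) 0)

variable [NeZero n]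

theorem finRotate_pow_val (k : ℕ) (i : Fin n) : ((finRotate n ^ k) i).val = (i.val + k) % n := by
  induction k with
  | zero => simp [Nat.mod_eq_of_lt i.isLt]
  | succ k ih =>
    have h := Nat.mod_lt (i.val + k) (Nat.pos_of_neZero n)
    rw [pow_succ', Equiv.Perm.mul_apply, finRotate_val, ih, ← add_assoc,
      ← Nat.mod_add_mod (i.val + k) n 1]
    split_ifs with h1
    · rw [h1, Nat.mod_self]
    · exact (Nat.mod_eq_of_lt (by omega)).symm

theorem finRotate_pow_zero_val {j : ℕ} (hj : j < n) : ((finRotate n ^ j) 0).val = j := by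
  rw [finRotate_pow_val, Fin.val_zero, zero_add, Nat.mod_eq_of_lt hj]

theorem cycProd_add (i k : ℕ) :
    cycProd K n (i + k) = cycProd K n i * (finRotate n ^ i) • cycProd K n k := by
  simp only [cycProd, Finset.prod_range_add, Finset.smul_prod', smul_q, ← Equiv.Perm.mul_apply,
    pow_add]

theorem cycProd_one : cycProd K n 1 = q K 0 := by simp [cycProd]

theorem cycProd_eq_prefixProd {k : ℕ} (hk : k ≤ n) : cycProd K n k = prefixProd K 1 k := by
  induction k with
  | zero => simp [cycProd, prefixProd_zero]
  | succ k ih =>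
    have h := prefixProd_succ (K := K) (1 : Equiv.Perm (Fin n)) ⟨k, hk⟩
    rw [h, ← ih (by omega), cycProd, Finset.prod_range_succ, ← cycProd]
    congr 2
    exact Fin.ext (finRotate_pow_zero_val hk)

theorem cycProd_self : cycProd K n n = 1 := by
  rw [cycProd_eq_prefixProd le_rfl, prefixProd_of_le _ le_rfl]

theorem cycProd_add_self (i : ℕ) : cycProd K n (i + n) = cycProd K n i := by
  rw [cycProd_add, cycProd_self, smul_one, mul_one]

theorem cycProd_mod (i : ℕ) : cycProd K n (i % n) = cycProd K n i :=
  (show Function.Periodic (cycProd K n) n from cycProd_add_self).map_mod_nat i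

theorem cycProd_ne_zero (i : ℕ) : cycProd K n i ≠ 0 :=
  Finset.prod_ne_zero_iff.mpr fun _ _ => q_ne_zero _

/-- The quotient of two values is a rotated prefix product of length strictly between 0 and `n`,
hence not 1. This makes the values usable as interpolation nodes. -/
theorem cycProd_injOn : Set.InjOn (cycProd K n) (Finset.range n) := by
  have key : ∀ i j, i < j → j < n → cycProd K n i ≠ cycProd K n j := by
    intro i j hij hj h
    obtain ⟨k, rfl⟩ := Nat.exists_eq_add_of_lt hij
    rw [add_assoc, cycProd_add] at h
    have h1 := mul_left_cancel₀ (cycProd_ne_zero i) ((mul_one _).trans h)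
    rw [cycProd_eq_prefixProd (by omega), smul_prefixProd] at h1
    exact prefixProd_ne_one _ (by omega) (by omega) h1.symm
  intro i hi j hj h
  have hi' := Finset.mem_range.mp hi
  have hj' := Finset.mem_range.mp hj
  rcases lt_trichotomy i j with h1 | h1 | h1
  · exact absurd h (key i j h1 hj')
  · exact h1
  · exact absurd h.symm (key j i h1 hi')

theorem cycProd_mul_qMaj (i : ℕ) :
    cycProd K n i * qMaj K (finRotate n ^ i) =
      (finRotate n ^ i) • qMaj K (1 : Equiv.Perm (Fin n)) := by
  induction i with
  | zero => simp [cycProd]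
  | succ i ih =>
    rw [pow_succ', mul_smul, ← ih, smul_mul', finRotate_smul_qMaj, add_comm i 1, cycProd_add,
      cycProd_one, pow_one]
    ring

/-- The Lagrange basis polynomials at the nodes `1 / c i` sum to 1; evaluate at 0. -/
theorem sum_prod_inv_sub {F ι : Type*} [Field F] [DecidableEq ι] (s : Finset ι)
    (hs : s.Nonempty) (c : ι → F) (hc : ∀ i, c i ≠ 0) (hinj : Set.InjOn c s) :
    ∑ i ∈ s, ∏ j ∈ s.erase i, (1 - c j / c i)⁻¹ = 1 := by
  have h := congrArg (Polynomial.eval 0)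
    (Lagrange.sum_basis (s := s) (v := fun i => (c i)⁻¹)
      (fun i hi j hj hij => hinj hi hj (inv_injective hij)) hs)
  rw [Polynomial.eval_finsetSum, Polynomial.eval_one] at h
  refine Eq.trans (Finset.sum_congr rfl fun i hi => ?_) h
  rw [Lagrange.basis, Polynomial.eval_prod]
  refine Finset.prod_congr rfl fun j hj => ?_
  obtain ⟨hji, hj⟩ := Finset.mem_erase.mp hj
  have h0 : c i - c j ≠ 0 := sub_ne_zero.mpr fun h => hji (hinj hj hi h.symm)
  have h0' : c j - c i ≠ 0 := sub_ne_zero.mpr fun h => hji (hinj hj hi h)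
  have h1 := hc i
  have h2 := hc j
  have h3 : 1 - c j / c i = (c i - c j) / c i := by field_simp
  have h4 : (c i)⁻¹ - (c j)⁻¹ = (c j - c i) / (c i * c j) := by field_simp
  simp only [Lagrange.basisDivisor, Polynomial.eval_mul, Polynomial.eval_C, Polynomial.eval_sub,
    Polynomial.eval_X]
  rw [h3, h4]
  field_simp
  ring

theorem sum_qMaj_mul_cycProd :
    ∑ i ∈ Finset.range n, qMaj K (finRotate n ^ i) * cycProd K n i = 1 := by
  have hn : 0 < n := Nat.pos_of_neZero n
  rw [← sum_prod_inv_sub (Finset.range n) ⟨0, Finset.mem_range.mpr hn⟩ (cycProd K n)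
    cycProd_ne_zero cycProd_injOn]
  refine Finset.sum_congr rfl fun i hi => ?_
  have hi := Finset.mem_range.mp hi
  rw [mul_comm, cycProd_mul_qMaj, qMaj, descentSet_one, Finset.prod_empty, smul_div_ratField,
    smul_one, one_div, Finset.smul_prod', ← Finset.prod_inv_distrib]
  -- By the cocycle rule `cycProd_add`, the `k`-th factor is `1 - c (i + k) / c i` with `c = cycProd
  -- K n`; by periodicity only `i + k` modulo `n` matters, and it runs over the residues other than
  -- `i`.
  refine Finset.prod_bij (fun k _ => (i + k) % n) ?_ ?_ ?_ ?_
  · intro k hk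
    have hk := Finset.mem_Ico.mp hk
    refine Finset.mem_erase.mpr ⟨?_, Finset.mem_range.mpr (Nat.mod_lt _ hn)⟩
    rw [Nat.mod_def]
    intro h
    rcases Nat.lt_or_ge (i + k) n with h1 | h1
    · rw [Nat.div_eq_of_lt h1] at h; omega
    · rw [Nat.div_eq_of_lt_le (k := 1) (by omega) (by omega)] at h; omega
  · intro a ha b hb h
    have ha := Finset.mem_Ico.mp ha
    have hb := Finset.mem_Ico.mp hb
    have h1 : a ≡ b [MOD n] := Nat.ModEq.add_left_cancel' i h
    exact h1.eq_of_lt_of_lt ha.2 hb.2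
  · intro j hj
    obtain ⟨hji, hj⟩ := Finset.mem_erase.mp hj
    have hj := Finset.mem_range.mp hj
    rcases Nat.lt_or_ge i j with h | h
    · refine ⟨j - i, Finset.mem_Ico.mpr ⟨by omega, by omega⟩, ?_⟩
      rw [Nat.add_sub_cancel' h.le, Nat.mod_eq_of_lt hj]
    · refine ⟨j + n - i, Finset.mem_Ico.mpr ⟨by omega, by omega⟩, ?_⟩
      rw [Nat.add_sub_cancel' (by omega), Nat.add_mod_right, Nat.mod_eq_of_lt hj]
  · intro k hk
    have hk := Finset.mem_Ico.mp hk
    rw [cycProd_mod, cycProd_add, mul_div_cancel_left₀ _ (cycProd_ne_zero i), smul_sub, smul_one,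
      cycProd_eq_prefixProd hk.2.le]

end Prefix

/-! ### Elements on which the long cycle acts by the scalar `q₁` -/

section Cyclic

variable {K : Type u} [Field K] {n : ℕ}

theorem single_mul_smul (σ : Equiv.Perm (Fin n)) (a c : RatField K n) (x : TwistedAlg K n) :
    (SkewMonoidAlgebra.single σ a : TwistedAlg K n) * (c • x) =
      (σ • c) • ((SkewMonoidAlgebra.single σ a : TwistedAlg K n) * x) := by
  induction x using SkewMonoidAlgebra.induction_on' with
  | single τ b =>
    simp only [SkewMonoidAlgebra.smul_single, single_mul_single_twisted, smul_eq_mul, smul_mul']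
    congr 1
    ring
  | add x y hx hy => rw [smul_add, mul_add, mul_add, smul_add, hx, hy]

theorem single_eq_smul (σ : Equiv.Perm (Fin n)) (a : RatField K n) :
    (SkewMonoidAlgebra.single σ a : TwistedAlg K n) = a • SkewMonoidAlgebra.single σ 1 := by
  rw [SkewMonoidAlgebra.smul_single, smul_eq_mul, mul_one]

theorem smul_mul_twisted (c : RatField K n) (x y : TwistedAlg K n) :
    (c • x) * y = c • (x * y) := by
  have h : ∀ z : TwistedAlg K n, c • z = SkewMonoidAlgebra.single 1 c * z := by
    intro z
    induction z using SkewMonoidAlgebra.induction_on' with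
    | single τ b =>
      rw [SkewMonoidAlgebra.smul_single, single_mul_single_twisted, one_smul, one_mul, smul_eq_mul]
    | add x y hx hy => rw [smul_add, mul_add, hx, hy]
  rw [h, h, mul_assoc]

variable [NeZero n]

theorem single_finRotate_mul_e :
    (SkewMonoidAlgebra.single (finRotate n) 1 : TwistedAlg K n) * e K n = q K (0 : Fin n) • e K n := by
  rw [e, Finset.mul_sum, Finset.smul_sum]
  simp only [single_mul_single_twisted, finRotate_smul_qMaj, SkewMonoidAlgebra.smul_single,
    smul_eq_mul, one_mul]
  exact Equiv.sum_comp (Equiv.mulLeft (finRotate n)) (fun σ =>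
    (SkewMonoidAlgebra.single σ (q K (0 : Fin n) * qMaj K σ) : TwistedAlg K n))

theorem finRotate_pow_self : finRotate n ^ n = 1 := by
  ext i
  rw [finRotate_pow_val, Nat.add_mod_right, Nat.mod_eq_of_lt i.isLt, Equiv.Perm.one_apply]

theorem single_finRotate_mul_theta :
    (SkewMonoidAlgebra.single (finRotate n) 1 : TwistedAlg K n) * theta K n =
      q K (0 : Fin n) • theta K n := by
  rw [theta, Finset.mul_sum, Finset.smul_sum]
  simp only [single_mul_single_twisted, finRotate_smul_qMaj, SkewMonoidAlgebra.smul_single,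
    smul_eq_mul, one_mul, ← pow_succ']
  let f : ℕ → TwistedAlg K n := fun i =>
    SkewMonoidAlgebra.single (finRotate n ^ i) (q K (0 : Fin n) * qMaj K (finRotate n ^ i))
  -- Left multiplication by `γ` shifts the summation index, and the shift closes up because `γ^n =
  -- 1`.
  have h0 : f n = f 0 := by simp only [f, finRotate_pow_self, pow_zero]
  have h := (Finset.sum_range_succ' f n).symm.trans (Finset.sum_range_succ f n)
  rw [h0] at h
  exact add_right_cancel h

theorem single_finRotate_pow_mul {x : TwistedAlg K n}
    (hx : (SkewMonoidAlgebra.single (finRotate n) 1 : TwistedAlg K n) * x = q K (0 : Fin n) • x) (i : ℕ) :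
    (SkewMonoidAlgebra.single (finRotate n ^ i) 1 : TwistedAlg K n) * x = cycProd K n i • x := by
  induction i with
  | zero => simp [cycProd]
  | succ i ih =>
    have h : (SkewMonoidAlgebra.single (finRotate n ^ (i + 1)) 1 : TwistedAlg K n) =
        SkewMonoidAlgebra.single (finRotate n) 1 * SkewMonoidAlgebra.single (finRotate n ^ i) 1 := by
      rw [single_mul_single_twisted, smul_one, mul_one, pow_succ']
    rw [h, mul_assoc, ih, single_mul_smul, hx, smul_smul, add_comm i 1, cycProd_add, cycProd_one,
      pow_one, mul_comm]

theorem theta_mul {x : TwistedAlg K n}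
    (hx : (SkewMonoidAlgebra.single (finRotate n) 1 : TwistedAlg K n) * x = q K (0 : Fin n) • x) :
    theta K n * x = x := by
  rw [theta, Finset.sum_mul]
  simp only [single_eq_smul _ (qMaj K _), smul_mul_twisted, single_finRotate_pow_mul hx, smul_smul]
  rw [← Finset.sum_smul, sum_qMaj_mul_cycProd, one_smul]

theorem exists_eq_mul_finRotate_pow (σ : Equiv.Perm (Fin n)) :
    ∃ (τ : Equiv.Perm (Fin n)) (i : ℕ), τ 0 = 0 ∧ σ = τ * finRotate n ^ i := by
  let m := (σ.symm 0).val
  have hm : (finRotate n ^ m) 0 = σ.symm 0 := Fin.ext (finRotate_pow_zero_val (σ.symm 0).isLt)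
  refine ⟨σ * finRotate n ^ m, n - m, ?_, ?_⟩
  · rw [Equiv.Perm.mul_apply, hm, Equiv.apply_symm_apply]
  · rw [mul_assoc, ← pow_add, Nat.add_sub_cancel' (σ.symm 0).isLt.le, finRotate_pow_self, mul_one]

/-- If `γ ⋉ x = q₁ x`, then `x` generates a left ideal spanned by `σ ⋉ x` with `σ(1) = 1`. -/
theorem mul_mem_span {x : TwistedAlg K n}
    (hx : (SkewMonoidAlgebra.single (finRotate n) 1 : TwistedAlg K n) * x = q K (0 : Fin n) • x)
    (a : TwistedAlg K n) :
    a * x ∈ Submodule.span (RatField K n)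
      (Set.range fun σ : {σ : Equiv.Perm (Fin n) // σ 0 = 0} =>
        (SkewMonoidAlgebra.single σ.1 1 * x : TwistedAlg K n)) := by
  induction a using SkewMonoidAlgebra.induction_on' with
  | single σ b =>
    obtain ⟨τ, i, hτ, rfl⟩ := exists_eq_mul_finRotate_pow σ
    have h : (SkewMonoidAlgebra.single (τ * finRotate n ^ i) 1 : TwistedAlg K n) =
        SkewMonoidAlgebra.single τ 1 * SkewMonoidAlgebra.single (finRotate n ^ i) 1 := by
      rw [single_mul_single_twisted, smul_one, mul_one]
    rw [single_eq_smul, smul_mul_twisted, h, mul_assoc, single_finRotate_pow_mul hx,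
      single_mul_smul]
    exact Submodule.smul_mem _ _ (Submodule.smul_mem _ _ (Submodule.subset_span ⟨⟨τ, hτ⟩, rfl⟩))
  | add a b ha hb => rw [add_mul]; exact Submodule.add_mem _ ha hb

end Cyclic

/-! ### Shuffle relations satisfied by Lie elements -/

section Shuffle

variable {F X : Type*} [Field F]

/-- The product of the letters of a list in the free associative algebra. -/
noncomputable def listWord (F : Type*) [Field F] {X : Type*} (l : List X) : FreeAlgebra F X :=
  (l.map (FreeAlgebra.ι F)).prod

/-- Restriction of words to the letters satisfying `p` and to those not satisfying `p`. -/
noncomputable def splitHom (F : Type*) [Field F] {X : Type*} (p : X → Prop) [DecidablePred p] :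
    FreeAlgebra F X →ₐ[F] MonoidAlgebra F (FreeMonoid X × FreeMonoid X) :=
  FreeAlgebra.lift F fun a => MonoidAlgebra.of F (FreeMonoid X × FreeMonoid X)
    (if p a then (FreeMonoid.of a, 1) else (1, FreeMonoid.of a))

theorem splitHom_listWord (p : X → Prop) [DecidablePred p] (l : List X) :
    splitHom F p (listWord F l) = MonoidAlgebra.of F (FreeMonoid X × FreeMonoid X)
      (FreeMonoid.ofList (l.filter fun a => decide (p a)),
        FreeMonoid.ofList (l.filter fun a => decide (¬ p a))) := by
  induction l with
  | nil =>
    have h : listWord F ([] : List X) = 1 := rfl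
    rw [h, map_one]
    exact (map_one (MonoidAlgebra.of F (FreeMonoid X × FreeMonoid X))).symm
  | cons a l ih =>
    have h : listWord F (a :: l) = FreeAlgebra.ι F a * listWord F l := by simp [listWord]
    rw [h, map_mul, ih, splitHom, FreeAlgebra.lift_ι_apply, ← map_mul]
    congr 1
    by_cases ha : p a
    · simp [ha, FreeMonoid.ofList_cons]
    · simp [ha, FreeMonoid.ofList_cons]

/-- The span of the pairs of words at least one of which is empty. -/
noncomputable def primitiveSpan (F : Type*) [Field F] (X : Type*) :
    Submodule F (MonoidAlgebra F (FreeMonoid X × FreeMonoid X)) :=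
  Submodule.span F (MonoidAlgebra.of F (FreeMonoid X × FreeMonoid X) ''
    {m | m.1 = 1 ∨ m.2 = 1})

/-- Words on opposite sides commute, so their bracket vanishes; words on the same side have products
on that side. -/
theorem primitiveSpan_bracket {x y : MonoidAlgebra F (FreeMonoid X × FreeMonoid X)}
    (hx : x ∈ primitiveSpan F X) (hy : y ∈ primitiveSpan F X) :
    x * y - y * x ∈ primitiveSpan F X := by
  induction hx, hy using Submodule.span_induction₂ with
  | mem_mem x y hx hy =>
    obtain ⟨⟨u, v⟩, hm, rfl⟩ := hx
    obtain ⟨⟨u', v'⟩, hm', rfl⟩ := hy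
    have key : ∀ m : FreeMonoid X × FreeMonoid X, m.1 = 1 ∨ m.2 = 1 →
        MonoidAlgebra.of F (FreeMonoid X × FreeMonoid X) m ∈ primitiveSpan F X :=
      fun m hm => Submodule.subset_span ⟨m, hm, rfl⟩
    rw [← map_mul, ← map_mul]
    rcases hm with rfl | rfl <;> rcases hm' with rfl | rfl
    · exact Submodule.sub_mem _ (key _ (by simp)) (key _ (by simp))
    · simp
    · simp
    · exact Submodule.sub_mem _ (key _ (by simp)) (key _ (by simp))
  | zero_left y hy => simp
  | zero_right x hx => simp
  | add_left x y z hx hy hz h1 h2 =>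
    have : (x + y) * z - z * (x + y) = (x * z - z * x) + (y * z - z * y) := by noncomm_ring
    rw [this]; exact Submodule.add_mem _ h1 h2
  | add_right x y z hx hy hz h1 h2 =>
    have : x * (y + z) - (y + z) * x = (x * y - y * x) + (x * z - z * x) := by noncomm_ring
    rw [this]; exact Submodule.add_mem _ h1 h2
  | smul_left r x y hx hy h =>
    rw [smul_mul_assoc, mul_smul_comm, ← smul_sub]; exact Submodule.smul_mem _ _ h
  | smul_right r x y hx hy h =>
    rw [smul_mul_assoc, mul_smul_comm, ← smul_sub]; exact Submodule.smul_mem _ _ h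

/-- Letters map to pairs with an empty side, and this property survives brackets. It is the source
of the shuffle relations. -/
theorem splitHom_mem_primitiveSpan (p : X → Prop) [DecidablePred p] {x : FreeAlgebra F X}
    (hx : x ∈ LieSubalgebra.lieSpan F (FreeAlgebra F X) (Set.range (FreeAlgebra.ι F))) :
    splitHom F p x ∈ primitiveSpan F X := by
  induction hx using LieSubalgebra.lieSpan_induction with
  | mem x hx =>
    obtain ⟨a, rfl⟩ := hx
    rw [splitHom, FreeAlgebra.lift_ι_apply]
    refine Submodule.subset_span ⟨_, ?_, rfl⟩
    split_ifs <;> simp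
  | zero => rw [map_zero]; exact Submodule.zero_mem _
  | add x y _ _ hx hy => rw [map_add]; exact Submodule.add_mem _ hx hy
  | smul r x _ hx => rw [map_smul]; exact Submodule.smul_mem _ _ hx
  | lie x y _ _ hx hy =>
    rw [LieRing.of_associative_ring_bracket, map_sub, map_mul, map_mul]
    exact primitiveSpan_bracket hx hy

/-- The linear functional on pairs of words with prescribed values. -/
noncomputable def pairFunctional (φ : FreeMonoid X × FreeMonoid X → F) :
    MonoidAlgebra F (FreeMonoid X × FreeMonoid X) →ₗ[F] F :=
  Finsupp.linearCombination F φ ∘ₗ (MonoidAlgebra.coeffLinearEquiv F).toLinearMap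

theorem pairFunctional_of (φ : FreeMonoid X × FreeMonoid X → F)
    (m : FreeMonoid X × FreeMonoid X) :
    pairFunctional φ (MonoidAlgebra.of F (FreeMonoid X × FreeMonoid X) m) = φ m := by
  simp [pairFunctional]

theorem pairFunctional_eq_zero (φ : FreeMonoid X × FreeMonoid X → F)
    (hφ : ∀ m : FreeMonoid X × FreeMonoid X, m.1 = 1 ∨ m.2 = 1 → φ m = 0)
    {x : MonoidAlgebra F (FreeMonoid X × FreeMonoid X)} (hx : x ∈ primitiveSpan F X) :
    pairFunctional φ x = 0 := by
  have h : primitiveSpan F X ≤ LinearMap.ker (pairFunctional φ) := by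
    refine Submodule.span_le.mpr ?_
    rintro _ ⟨m, hm, rfl⟩
    exact (pairFunctional_of φ m).trans (hφ m hm)
  exact h hx

end Shuffle

/-! ### Shuffle relations on coefficients, and right multiplication by `e` -/

section LieElements

variable {K : Type u} [Field K] {n : ℕ}

theorem word_eq_listWord (σ : Equiv.Perm (Fin n)) :
    word K σ = listWord (RatField K n) (List.ofFn σ) := by
  rw [listWord, List.map_ofFn]; rfl

theorem toWords_single (σ : Equiv.Perm (Fin n)) (c : RatField K n) :
    toWords K n (SkewMonoidAlgebra.single σ c) = c • word K σ := by
  simp [toWords, SkewMonoidAlgebra.coeffLinearEquiv]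

theorem twisted_eq_sum (x : TwistedAlg K n) :
    x = ∑ σ : Equiv.Perm (Fin n), SkewMonoidAlgebra.single σ (x.coeff σ) := by
  induction x using SkewMonoidAlgebra.induction_on' with
  | single σ b =>
    rw [Finset.sum_eq_single σ]
    · simp
    · intro τ _ h
      simp [h.symm]
    · simp
  | add x y hx hy =>
    conv_lhs => rw [hx, hy]
    simp [SkewMonoidAlgebra.single_add, Finset.sum_add_distrib]

theorem pair_sublist_ofFn (σ : Equiv.Perm (Fin n)) (a b : Fin n) :
    [a, b].Sublist (List.ofFn σ) ↔ σ⁻¹ a < σ⁻¹ b := by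
  constructor
  · have h : (List.ofFn σ).Pairwise fun a b => σ⁻¹ a < σ⁻¹ b := by
      rw [List.pairwise_ofFn]
      intro i j hij
      simpa using hij
    exact fun h' => List.pairwise_iff_forall_sublist.mp h h'
  · have h : (List.ofFn σ).Pairwise fun a b => [a, b].Sublist (List.ofFn σ) :=
      List.pairwise_iff_forall_sublist.mpr fun h => h
    rw [List.pairwise_ofFn] at h
    intro hab
    simpa using h hab

theorem pair_sublist_filter {X : Type*} (p : X → Bool) (l : List X) (a b : X) (ha : p a = true)
    (hb : p b = true) : [a, b].Sublist (l.filter p) ↔ [a, b].Sublist l := by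
  constructor
  · exact fun h => h.trans List.filter_sublist
  · intro h
    have := h.filter p
    simpa [ha, hb] using this

-- The disjointness condition says that `ρ(j)` precedes `ρ(j+1)` in the word `τ` for each `j ∈ T`.
-- Since `s ∉ T`, cutting `ρ` after its first `s` letters separates none of these pairs, so the
-- condition depends only on the restrictions of `τ` to the two blocks. Both blocks are nonempty, so
-- the corresponding functional kills the image of a Lie element.
open Classical in
theorem sum_coeff_eq_zero {x : TwistedAlg K n} (hx : x ∈ lieElements K n)
    (ρ : Equiv.Perm (Fin n)) (T : Finset ℕ) {s : ℕ} (hs : s ∈ Finset.Ico 1 n) (hsT : s ∉ T) :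
    ∑ τ : Equiv.Perm (Fin n), x.coeff τ *
      (if Disjoint T (descentSet (τ⁻¹ * ρ)) then 1 else 0) = 0 := by
  have hs := Finset.mem_Ico.mp hs
  let p : Fin n → Prop := fun a => (ρ⁻¹ a).val < s
  -- The two nonemptiness clauses hold for every `τ`; they are there to make `φ` vanish on
  -- `primitiveSpan`.
  let good : FreeMonoid (Fin n) × FreeMonoid (Fin n) → Prop := fun m =>
    m.1 ≠ 1 ∧ m.2 ≠ 1 ∧ ∀ (i : ℕ) (h : i + 1 < n), i + 1 ∈ T →
      [ρ ⟨i, by omega⟩, ρ ⟨i + 1, h⟩].Sublist m.1.toList ∨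
      [ρ ⟨i, by omega⟩, ρ ⟨i + 1, h⟩].Sublist m.2.toList
  let φ : FreeMonoid (Fin n) × FreeMonoid (Fin n) → RatField K n :=
    fun m => if good m then 1 else 0
  have h0 : pairFunctional φ (splitHom (RatField K n) p (toWords K n x)) = 0 := by
    refine pairFunctional_eq_zero φ ?_ (splitHom_mem_primitiveSpan p hx)
    rintro m (h | h) <;> simp [φ, good, h]
  have h1 : ∀ τ : Equiv.Perm (Fin n),
      pairFunctional φ (splitHom (RatField K n) p (word K τ)) =
        if Disjoint T (descentSet (τ⁻¹ * ρ)) then 1 else 0 := by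
    intro τ
    rw [word_eq_listWord, splitHom_listWord, pairFunctional_of]
    refine if_congr ?_ rfl rfl
    have hmem : ∀ a : Fin n, a ∈ List.ofFn τ := fun a =>
      List.mem_ofFn.mpr ⟨τ⁻¹ a, by simp⟩
    have hu : (FreeMonoid.ofList ((List.ofFn τ).filter fun a => decide (p a))) ≠ 1 := by
      intro h
      have : ρ ⟨0, by omega⟩ ∈ (List.ofFn τ).filter fun a => decide (p a) :=
        List.mem_filter.mpr ⟨hmem _, by simp [p]; omega⟩
      rw [show (List.ofFn τ).filter (fun a => decide (p a)) = [] from h] at this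
      exact List.not_mem_nil this
    have hv : (FreeMonoid.ofList ((List.ofFn τ).filter fun a => decide (¬ p a))) ≠ 1 := by
      intro h
      have : ρ ⟨s, by omega⟩ ∈ (List.ofFn τ).filter fun a => decide (¬ p a) :=
        List.mem_filter.mpr ⟨hmem _, by simp [p]⟩
      rw [show (List.ofFn τ).filter (fun a => decide (¬ p a)) = [] from h] at this
      exact List.not_mem_nil this
    have hpair : ∀ (i : ℕ) (h : i + 1 < n), i + 1 ∈ T →
        (([ρ ⟨i, by omega⟩, ρ ⟨i + 1, h⟩].Sublist ((List.ofFn τ).filter fun a => decide (p a)) ∨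
          [ρ ⟨i, by omega⟩, ρ ⟨i + 1, h⟩].Sublist
            ((List.ofFn τ).filter fun a => decide (¬ p a))) ↔
        i + 1 ∉ descentSet (τ⁻¹ * ρ)) := by
      intro i h hi
      have his : i + 1 ≠ s := fun h => hsT (h ▸ hi)
      have hne : τ⁻¹ (ρ ⟨i, by omega⟩) ≠ τ⁻¹ (ρ ⟨i + 1, h⟩) := by
        simp
      have hiff : i + 1 ∉ descentSet (τ⁻¹ * ρ) ↔
          [ρ ⟨i, by omega⟩, ρ ⟨i + 1, h⟩].Sublist (List.ofFn τ) := by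
        rw [mem_descentSet _ h, pair_sublist_ofFn, not_lt]
        exact ⟨fun h => lt_of_le_of_ne h hne, le_of_lt⟩
      rw [hiff]
      constructor
      · rintro (h | h) <;> exact h.trans List.filter_sublist
      · intro h'
        rcases Nat.lt_or_ge (i + 1) s with h2 | h2
        · left
          rw [pair_sublist_filter _ _ _ _ (by simp [p]; omega) (by simp [p]; omega)]
          exact h'
        · right
          rw [pair_sublist_filter _ _ _ _ (by simp [p]; omega) (by simp [p]; omega)]
          exact h'
    constructor
    · rintro ⟨-, -, h⟩
      rw [Finset.disjoint_left]
      intro j hj hjD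
      have hjn := Finset.mem_Ico.mp (Finset.mem_filter.mp hjD).1
      obtain ⟨i, rfl⟩ : ∃ i, j = i + 1 := ⟨j - 1, by omega⟩
      exact (hpair i hjn.2 hj).mp (h i hjn.2 hj) hjD
    · intro h
      exact ⟨hu, hv, fun i hi hiT => (hpair i hi hiT).mpr (Finset.disjoint_left.mp h hiT)⟩
  rw [twisted_eq_sum x, map_sum, map_sum, map_sum] at h0
  simpa only [toWords_single, map_smul, h1, smul_eq_mul] using h0

theorem eq_one_of_descentSet_eq_empty {σ : Equiv.Perm (Fin n)} (h : descentSet σ = ∅) : σ = 1 := by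
  cases n with
  | zero => exact Subsingleton.elim _ _
  | succ m =>
    have hmono : StrictMono σ := by
      rw [Fin.strictMono_iff_lt_succ]
      intro i
      have hi : i.val + 1 ∉ descentSet σ := by simp [h]
      rw [mem_descentSet σ (by omega), not_lt] at hi
      exact lt_of_le_of_ne hi fun h => by
        have := congrArg Fin.val (σ.injective h)
        simp at this
    ext i
    have h1 := Subsingleton.elim (hmono.orderIsoOfSurjective σ σ.surjective) (OrderIso.refl _)
    exact congrArg Fin.val (DFunLike.congr_fun h1 i)

-- Write the product over descents as `∏ (t j + (1 - t j)[j not a descent])` and expand over the set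
-- `S` of indices where `t j` is chosen. For nonempty `S`, any `s ∈ S` makes `sum_coeff_eq_zero`
-- apply to the complement; for `S = ∅` there are no descents, which forces `τ = ρ`.
open Classical in
theorem sum_coeff_mul_prod {x : TwistedAlg K n} (hx : x ∈ lieElements K n)
    (ρ : Equiv.Perm (Fin n)) (t : ℕ → RatField K n) :
    ∑ τ : Equiv.Perm (Fin n), x.coeff τ * ∏ j ∈ descentSet (τ⁻¹ * ρ), t j =
      x.coeff ρ * ∏ j ∈ Finset.Ico 1 n, (1 - t j) := by
  have hexp : ∀ σ : Equiv.Perm (Fin n), ∏ j ∈ descentSet σ, t j =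
      ∑ S ∈ (Finset.Ico 1 n).powerset, ((∏ j ∈ S, t j) * ∏ j ∈ Finset.Ico 1 n \ S, (1 - t j)) *
        (if Disjoint (Finset.Ico 1 n \ S) (descentSet σ) then 1 else 0) := by
    intro σ
    have h1 : ∏ j ∈ descentSet σ, t j =
        ∏ j ∈ Finset.Ico 1 n, (t j + (1 - t j) * (if j ∈ descentSet σ then 0 else 1)) := by
      have h2 : descentSet σ = (Finset.Ico 1 n).filter (· ∈ descentSet σ) := by
        rw [Finset.filter_mem_eq_inter, Finset.inter_eq_right.mpr]
        exact Finset.filter_subset _ _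
      conv_lhs => rw [h2, Finset.prod_filter]
      refine Finset.prod_congr rfl fun j _ => ?_
      split_ifs <;> ring
    rw [h1, Finset.prod_add]
    refine Finset.sum_congr rfl fun S _ => ?_
    rw [Finset.prod_mul_distrib, mul_assoc]
    congr 2
    split_ifs with h
    · exact Finset.prod_eq_one fun j hj => if_neg (Finset.disjoint_left.mp h hj)
    · obtain ⟨j, hj, hj'⟩ := Finset.not_disjoint_iff.mp h
      exact Finset.prod_eq_zero hj (if_pos hj')
  simp only [hexp, Finset.mul_sum]
  rw [Finset.sum_comm, Finset.sum_eq_single ∅]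
  · have h1 : ∀ τ : Equiv.Perm (Fin n),
        Disjoint (Finset.Ico 1 n) (descentSet (τ⁻¹ * ρ)) ↔ τ = ρ := by
      intro τ
      constructor
      · intro h
        have h2 := eq_one_of_descentSet_eq_empty
          (Finset.disjoint_self_iff_empty _ |>.mp (h.mono_left (Finset.filter_subset _ _)))
        exact inv_mul_eq_one.mp h2
      · rintro rfl
        rw [inv_mul_cancel, descentSet_one]
        exact Finset.disjoint_empty_right _
    simp only [h1, Finset.prod_empty, one_mul, Finset.sdiff_empty, mul_ite, mul_one, mul_zero,
      Finset.sum_ite_eq', Finset.mem_univ, if_true]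
  · intro S hS hne
    obtain ⟨s, hs⟩ := Finset.nonempty_iff_ne_empty.mpr hne
    have h := sum_coeff_eq_zero hx ρ (Finset.Ico 1 n \ S) (Finset.mem_powerset.mp hS hs)
      (by simp [hs])
    calc _ = ((∏ j ∈ S, t j) * ∏ j ∈ Finset.Ico 1 n \ S, (1 - t j)) *
        ∑ τ : Equiv.Perm (Fin n), x.coeff τ *
          (if Disjoint (Finset.Ico 1 n \ S) (descentSet (τ⁻¹ * ρ)) then 1 else 0) := by
          rw [Finset.mul_sum]
          exact Finset.sum_congr rfl fun τ _ => by ring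
      _ = 0 := by rw [h, mul_zero]
  · intro h
    exact absurd (Finset.empty_mem_powerset _) h

/-- `eₙ(q)` acts from the right as the identity on Lie elements. -/
theorem mul_e_of_mem_lieElements {x : TwistedAlg K n} (hx : x ∈ lieElements K n) :
    x * e K n = x := by
  have hden : ∀ ρ : Equiv.Perm (Fin n), ∏ j ∈ Finset.Ico 1 n, (1 - prefixProd K ρ j) ≠ 0 :=
    fun ρ => Finset.prod_ne_zero_iff.mpr fun j hj => by
      have hj := Finset.mem_Ico.mp hj
      exact sub_ne_zero.mpr (prefixProd_ne_one ρ hj.1 hj.2).symm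
  -- With `ρ = τσ`, the action of `τ` turns the prefix products of `σ` into those of `ρ`, while the
  -- descents remain those of `τ⁻¹ρ`. For fixed `ρ` the weights are then independent of `τ`, as
  -- `sum_coeff_mul_prod` requires.
  have h1 : ∀ τ : Equiv.Perm (Fin n),
      (SkewMonoidAlgebra.single τ (x.coeff τ) : TwistedAlg K n) * e K n =
      ∑ ρ : Equiv.Perm (Fin n), SkewMonoidAlgebra.single ρ
        (x.coeff τ * ((∏ j ∈ descentSet (τ⁻¹ * ρ), prefixProd K ρ j) /
          ∏ j ∈ Finset.Ico 1 n, (1 - prefixProd K ρ j))) := by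
    intro τ
    rw [e, Finset.mul_sum, ← Equiv.sum_comp (Equiv.mulLeft τ) fun ρ =>
      (SkewMonoidAlgebra.single ρ (x.coeff τ * ((∏ j ∈ descentSet (τ⁻¹ * ρ), prefixProd K ρ j) /
        ∏ j ∈ Finset.Ico 1 n, (1 - prefixProd K ρ j))) : TwistedAlg K n)]
    refine Finset.sum_congr rfl fun σ _ => ?_
    rw [single_mul_single_twisted, qMaj, smul_div_ratField, Finset.smul_prod', Finset.smul_prod']
    simp [smul_sub, smul_prefixProd]
  conv_lhs => rw [twisted_eq_sum x, Finset.sum_mul]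
  simp only [h1]
  rw [Finset.sum_comm]
  conv_rhs => rw [twisted_eq_sum x]
  refine Finset.sum_congr rfl fun ρ _ => ?_
  refine (map_sum (SkewMonoidAlgebra.singleAddHom ρ) _ Finset.univ).symm.trans ?_
  simp only [← mul_div_assoc]
  rw [← Finset.sum_div, sum_coeff_mul_prod hx, mul_div_cancel_right₀ _ (hden ρ)]
  rfl

end LieElements

/-! ### Left-normed brackets -/

section Bracket

variable {F X : Type*} [Field F]

theorem listWord_concat (l : List X) (b : X) :
    listWord F (l ++ [b]) = listWord F l * FreeAlgebra.ι F b := by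
  simp [listWord]

theorem listWord_cons (l : List X) (b : X) :
    listWord F (b :: l) = FreeAlgebra.ι F b * listWord F l := by
  simp [listWord]

/-- The left-normed bracket of the letters `a, l₁, l₂, …`. -/
noncomputable def leftBracket (F : Type*) [Field F] {X : Type*} (a : X) (l : List X) :
    FreeAlgebra F X :=
  l.foldl (fun x b => ⁅x, FreeAlgebra.ι F b⁆) (FreeAlgebra.ι F a)

theorem leftBracket_concat (a : X) (l : List X) (b : X) :
    leftBracket F a (l ++ [b]) =
      leftBracket F a l * FreeAlgebra.ι F b - FreeAlgebra.ι F b * leftBracket F a l := by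
  rw [leftBracket, List.foldl_append, List.foldl_cons, List.foldl_nil,
    LieRing.of_associative_ring_bracket, leftBracket]

theorem leftBracket_mem_lieSpan (a : X) (l : List X) :
    leftBracket F a l ∈
      LieSubalgebra.lieSpan F (FreeAlgebra F X) (Set.range (FreeAlgebra.ι F)) := by
  have hι : ∀ b : X, FreeAlgebra.ι F b ∈
      LieSubalgebra.lieSpan F (FreeAlgebra F X) (Set.range (FreeAlgebra.ι F)) :=
    fun b => LieSubalgebra.subset_lieSpan ⟨b, rfl⟩
  induction l using List.reverseRecOn with
  | nil => exact hι a
  | append_singleton l b ih =>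
    rw [leftBracket_concat, ← LieRing.of_associative_ring_bracket]
    exact LieSubalgebra.lie_mem _ ih (hι b)

/-- Each bracketing puts the new letter on the right, or on the left with a minus sign. Only the
choice of the right at every step leaves `a` in front. -/
theorem leftBracket_sub_listWord_mem (a : X) (l : List X) (ha : a ∉ l) :
    leftBracket F a l - listWord F (a :: l) ∈
      Submodule.span F (listWord F '' {w | w.Perm (a :: l) ∧ w.head? ≠ some a}) := by
  induction l using List.reverseRecOn with
  | nil => simp [leftBracket, listWord]
  | append_singleton l b ih =>
    have hab : b ≠ a := fun h => ha (by simp [h])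
    replace ih := ih fun h => ha (by simp [h])
    set y := leftBracket F a l - listWord F (a :: l) with hy
    have hl : leftBracket F a l = listWord F (a :: l) + y := by rw [hy]; abel
    have hcons : ∀ w : List X, w.Perm (a :: l) → listWord F (b :: w) ∈ Submodule.span F
        (listWord F '' {w | w.Perm (a :: (l ++ [b])) ∧ w.head? ≠ some a}) := by
      intro w hw
      refine Submodule.subset_span ⟨b :: w, ⟨?_, by simp [hab]⟩, rfl⟩
      exact (hw.cons b).trans (List.perm_append_singleton b (a :: l)).symm
    have h1 : y * FreeAlgebra.ι F b ∈ Submodule.span F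
        (listWord F '' {w | w.Perm (a :: (l ++ [b])) ∧ w.head? ≠ some a}) ∧
        FreeAlgebra.ι F b * y ∈ Submodule.span F
        (listWord F '' {w | w.Perm (a :: (l ++ [b])) ∧ w.head? ≠ some a}) := by
      clear_value y
      clear hy hl
      induction ih using Submodule.span_induction with
      | mem x hx =>
        obtain ⟨w, ⟨hw, hwa⟩, rfl⟩ := hx
        rw [← listWord_concat, ← listWord_cons]
        refine ⟨Submodule.subset_span ⟨w ++ [b], ⟨hw.append_right [b], ?_⟩, rfl⟩, hcons w hw⟩
        cases w with
        | nil => simp at hw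
        | cons c w => simpa using hwa
      | zero => simp
      | add x y _ _ hx hy =>
        rw [add_mul, mul_add]
        exact ⟨Submodule.add_mem _ hx.1 hy.1, Submodule.add_mem _ hx.2 hy.2⟩
      | smul r x _ hx =>
        rw [smul_mul_assoc, mul_smul_comm]
        exact ⟨Submodule.smul_mem _ _ hx.1, Submodule.smul_mem _ _ hx.2⟩
    have h2 : leftBracket F a (l ++ [b]) - listWord F (a :: (l ++ [b])) =
        y * FreeAlgebra.ι F b - listWord F (b :: a :: l) - FreeAlgebra.ι F b * y := by
      rw [leftBracket_concat, hl, ← List.cons_append, listWord_concat, listWord_cons (a :: l) b]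
      noncomm_ring
    rw [h2]
    exact Submodule.sub_mem _ (Submodule.sub_mem _ h1.1 (hcons _ (List.Perm.refl _))) h1.2

end Bracket

/-! ### Lower bound for the dimension of the space of Lie elements -/

section Dimension

variable {K : Type u} [Field K] {n : ℕ}

/-- The coefficient of `σ`, as a linear functional. -/
noncomputable def coeffAt (K : Type u) [Field K] {n : ℕ} (σ : Equiv.Perm (Fin n)) :
    TwistedAlg K n →ₗ[RatField K n] RatField K n :=
  Finsupp.lapply σ ∘ₗ (SkewMonoidAlgebra.coeffLinearEquiv (S := RatField K n)).toLinearMap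

theorem coeffAt_single (σ τ : Equiv.Perm (Fin n)) (c : RatField K n) :
    coeffAt K σ (SkewMonoidAlgebra.single τ c) = if τ = σ then c else 0 := by
  classical
  simp [coeffAt, SkewMonoidAlgebra.coeffLinearEquiv, Finsupp.single_apply]

theorem exists_ofFn_eq_of_perm (σ : Equiv.Perm (Fin n)) {w : List (Fin n)}
    (hw : w.Perm (List.ofFn σ)) : ∃ τ : Equiv.Perm (Fin n), List.ofFn τ = w := by
  have hlen : w.length = n := by simpa using hw.length_eq
  have hnd : w.Nodup := hw.nodup_iff.mpr (List.nodup_ofFn.mpr σ.injective)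
  have hinj : Function.Injective fun i : Fin n => w.get (i.cast hlen.symm) :=
    (List.nodup_iff_injective_get.mp hnd).comp (Fin.cast_injective hlen.symm)
  refine ⟨Equiv.ofBijective _ (Finite.injective_iff_bijective.mp hinj), ?_⟩
  exact List.ext_getElem (by simp [hlen]) fun i h1 h2 => by simp

/-- The witness is the left-normed bracket of the letters of `σ` in order. -/
theorem exists_mem_lieElements [NeZero n] (σ : Equiv.Perm (Fin n)) :
    ∃ x ∈ lieElements K n, coeffAt K σ x = 1 ∧
      ∀ τ : Equiv.Perm (Fin n), τ 0 = σ 0 → τ ≠ σ → coeffAt K τ x = 0 := by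
  obtain ⟨m, rfl⟩ : ∃ m, n = m + 1 := ⟨n - 1, by have := NeZero.ne n; omega⟩
  let l : List (Fin (m + 1)) := List.ofFn fun i : Fin m => σ i.succ
  have hl : List.ofFn σ = σ 0 :: l := List.ofFn_succ
  have hnd : (σ 0 :: l).Nodup := hl ▸ List.nodup_ofFn.mpr σ.injective
  have h1 := leftBracket_sub_listWord_mem (F := RatField K (m + 1)) (σ 0) l
    (List.nodup_cons.mp hnd).1
  -- The remaining words rearrange the letters of `σ`, so they lift to permutations with a different
  -- first letter. Coefficients are read off this lift, so injectivity of `toWords` is not needed.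
  have h2 : Submodule.span (RatField K (m + 1)) (listWord (RatField K (m + 1)) ''
        {w | w.Perm (σ 0 :: l) ∧ w.head? ≠ some (σ 0)}) ≤
      (Submodule.span (RatField K (m + 1)) ((fun τ : Equiv.Perm (Fin (m + 1)) =>
        (SkewMonoidAlgebra.single τ 1 : TwistedAlg K (m + 1))) '' {τ | τ 0 ≠ σ 0})).map
        (toWords K (m + 1)) := by
    refine Submodule.span_le.mpr ?_
    rintro _ ⟨w, ⟨hw, hwa⟩, rfl⟩
    rw [← hl] at hw
    obtain ⟨τ, rfl⟩ := exists_ofFn_eq_of_perm σ hw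
    refine ⟨SkewMonoidAlgebra.single τ 1, Submodule.subset_span ⟨τ, ?_, rfl⟩, ?_⟩
    · intro h
      apply hwa
      rw [List.ofFn_succ, List.head?_cons, h]
    · rw [toWords_single, one_smul, word_eq_listWord]
  obtain ⟨y, hy, hy'⟩ := h2 h1
  have hy0 : ∀ τ : Equiv.Perm (Fin (m + 1)), τ 0 = σ 0 → coeffAt K τ y = 0 := by
    intro τ hτ
    have h3 : Submodule.span (RatField K (m + 1)) ((fun τ : Equiv.Perm (Fin (m + 1)) =>
        (SkewMonoidAlgebra.single τ 1 : TwistedAlg K (m + 1))) '' {τ | τ 0 ≠ σ 0}) ≤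
        LinearMap.ker (coeffAt K τ) := by
      refine Submodule.span_le.mpr ?_
      rintro _ ⟨ρ, hρ, rfl⟩
      have : ρ ≠ τ := fun h => hρ (h ▸ hτ)
      exact (coeffAt_single τ ρ 1).trans (if_neg this)
    exact h3 hy
  refine ⟨SkewMonoidAlgebra.single σ 1 + y, ?_, ?_, ?_⟩
  · change toWords K (m + 1) _ ∈ freeLie K (m + 1)
    rw [map_add, hy', toWords_single, one_smul, word_eq_listWord, hl, add_sub_cancel]
    exact leftBracket_mem_lieSpan _ _
  · rw [map_add, coeffAt_single, if_pos rfl, hy0 σ rfl, add_zero]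
  · intro τ hτ hne
    rw [map_add, coeffAt_single, if_neg hne.symm, hy0 τ hτ, add_zero]

instance instFiniteTwistedAlg (K : Type u) [Field K] (n : ℕ) :
    Module.Finite (RatField K n) (TwistedAlg K n) :=
  Module.Finite.equiv
    (SkewMonoidAlgebra.coeffLinearEquiv (k := RatField K n) (G := Equiv.Perm (Fin n))
      (S := RatField K n)).symm

theorem card_perm_fix_zero (n : ℕ) [NeZero n] :
    Fintype.card {σ : Equiv.Perm (Fin n) // σ 0 = 0} = (n - 1).factorial := by
  obtain ⟨m, rfl⟩ : ∃ m, n = m + 1 := ⟨n - 1, by have := NeZero.ne n; omega⟩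
  have h : ∀ σ : Equiv.Perm (Fin (m + 1)), (Equiv.Perm.decomposeFin σ).1 = σ 0 := fun σ => by
    conv_rhs => rw [← Equiv.Perm.decomposeFin.symm_apply_apply σ]
    exact (Equiv.Perm.decomposeFin_symm_apply_zero _ _).symm
  let f : {σ : Equiv.Perm (Fin (m + 1)) // σ 0 = 0} ≃ Equiv.Perm (Fin m) :=
    { toFun := fun σ => (Equiv.Perm.decomposeFin σ.1).2
      invFun := fun τ => ⟨Equiv.Perm.decomposeFin.symm (0, τ),
        Equiv.Perm.decomposeFin_symm_apply_zero _ _⟩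
      left_inv := fun σ => Subtype.ext (by
        rw [Equiv.symm_apply_eq]
        exact Prod.ext ((h σ.1).trans σ.2).symm rfl)
      right_inv := fun τ => by simp }
  rw [Fintype.card_congr f, Fintype.card_perm, Fintype.card_fin, Nat.add_sub_cancel]

/-- The brackets beginning with the letter 1 are dual to the coefficient functionals at permutations
fixing 1. -/
theorem factorial_le_finrank_lieElements [NeZero n] :
    (n - 1).factorial ≤ Module.finrank (RatField K n) (lieElements K n) := by
  classical
  choose x hx hx1 hx0 using exists_mem_lieElements (K := K) (n := n)
  let v : {σ : Equiv.Perm (Fin n) // σ 0 = 0} → lieElements K n := fun σ => ⟨x σ.1, hx σ.1⟩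
  let f : lieElements K n →ₗ[RatField K n] ({σ : Equiv.Perm (Fin n) // σ 0 = 0} → RatField K n) :=
    LinearMap.pi fun σ => coeffAt K σ.1 ∘ₗ (lieElements K n).subtype
  have hf : f ∘ v = fun σ => Pi.single σ 1 := by
    funext σ τ
    change coeffAt K τ.1 (x σ.1) = _
    by_cases h : τ = σ
    · rw [h, hx1, Pi.single_eq_same]
    · rw [Pi.single_eq_of_ne h]
      exact hx0 σ.1 τ.1 (τ.2.trans σ.2.symm) fun h' => h (Subtype.ext h')
  have hv : LinearIndependent (RatField K n) v := by
    refine LinearIndependent.of_comp f ?_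
    rw [hf]
    exact Pi.linearIndependent_single_one _ _
  rw [← card_perm_fix_zero]
  exact hv.fintype_card_le_finrank

end Dimension

/-! ### The main theorem -/

section Main

variable {K : Type u} [Field K] {n : ℕ}

/-- Right multiplication as a `K(q)`-linear map. -/
noncomputable def mulRightMap (x : TwistedAlg K n) :
    TwistedAlg K n →ₗ[RatField K n] TwistedAlg K n where
  toFun a := a * x
  map_add' a b := add_mul a b x
  map_smul' c a := smul_mul_twisted c a x

/-- Presents the left ideal as a `K(q)`-subspace with `(n-1)!` generators, so that dimensions can be
compared. -/
theorem coe_ideal_span_eq [NeZero n] {x : TwistedAlg K n}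
    (hx : (SkewMonoidAlgebra.single (finRotate n) 1 : TwistedAlg K n) * x =
      q K (0 : Fin n) • x) :
    ((Ideal.span {x} : Ideal (TwistedAlg K n)) : Set (TwistedAlg K n)) =
      Submodule.span (RatField K n) (Set.range fun σ : {σ : Equiv.Perm (Fin n) // σ 0 = 0} =>
        (SkewMonoidAlgebra.single σ.1 1 * x : TwistedAlg K n)) := by
  apply Set.Subset.antisymm
  · intro y hy
    obtain ⟨a, rfl⟩ := Ideal.mem_span_singleton'.mp hy
    exact mul_mem_span hx a
  · have h : Submodule.span (RatField K n)
        (Set.range fun σ : {σ : Equiv.Perm (Fin n) // σ 0 = 0} =>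
        (SkewMonoidAlgebra.single σ.1 1 * x : TwistedAlg K n)) ≤ LinearMap.range (mulRightMap x) :=
      Submodule.span_le.mpr (by rintro _ ⟨σ, rfl⟩; exact ⟨_, rfl⟩)
    intro y hy
    obtain ⟨a, rfl⟩ := h hy
    exact Ideal.mem_span_singleton'.mpr ⟨a, rfl⟩

theorem finrank_span_le [NeZero n] (x : TwistedAlg K n) :
    Module.finrank (RatField K n) (Submodule.span (RatField K n)
      (Set.range fun σ : {σ : Equiv.Perm (Fin n) // σ 0 = 0} =>
        (SkewMonoidAlgebra.single σ.1 1 * x : TwistedAlg K n))) ≤ (n - 1).factorial := by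
  rw [← card_perm_fix_zero]
  exact finrank_range_le_card _

end Main

end QKlyachko

theorem mainTheorem4 (K : Type*) [Field K] [CharZero K] (n : ℕ) [NeZero n] :
    -- the left ideal generated by `eₙ(q)` is `Lₙ(q)`
    ((Ideal.span {QKlyachko.e K n} : Ideal (QKlyachko.TwistedAlg K n)) :
        Set (QKlyachko.TwistedAlg K n)) = QKlyachko.lieElements K n ∧
    -- `dim Lₙ(q) = (n - 1)!`
    Module.finrank (QKlyachko.RatField K n) (QKlyachko.lieElements K n) = (n - 1).factorial ∧
    -- right multiplication by `θₙ(q)` is a bijection between the two left ideals,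
    -- with inverse right multiplication by `eₙ(q)`
    Set.BijOn (fun x : QKlyachko.TwistedAlg K n => x * QKlyachko.theta K n)
      (Ideal.span {QKlyachko.e K n} : Ideal (QKlyachko.TwistedAlg K n))
      (Ideal.span {QKlyachko.theta K n} : Ideal (QKlyachko.TwistedAlg K n)) ∧
    Set.InvOn (fun y : QKlyachko.TwistedAlg K n => y * QKlyachko.e K n)
      (fun x : QKlyachko.TwistedAlg K n => x * QKlyachko.theta K n)
      (Ideal.span {QKlyachko.e K n} : Ideal (QKlyachko.TwistedAlg K n))
      (Ideal.span {QKlyachko.theta K n} : Ideal (QKlyachko.TwistedAlg K n)) ∧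
    -- the elements `σ ⋉ θₙ(q)` with `σ(1) = 1` form a `K(q)`-basis of the second left ideal
    LinearIndependent (QKlyachko.RatField K n)
      (fun σ : {σ : Equiv.Perm (Fin n) // σ 0 = 0} =>
        (SkewMonoidAlgebra.single σ.1 1 * QKlyachko.theta K n : QKlyachko.TwistedAlg K n)) ∧
    (Submodule.span (QKlyachko.RatField K n)
        (Set.range fun σ : {σ : Equiv.Perm (Fin n) // σ 0 = 0} =>
          (SkewMonoidAlgebra.single σ.1 1 * QKlyachko.theta K n : QKlyachko.TwistedAlg K n)) :
        Set (QKlyachko.TwistedAlg K n)) =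
      (Ideal.span {QKlyachko.theta K n} : Ideal (QKlyachko.TwistedAlg K n)) := by
  have he := QKlyachko.single_finRotate_mul_e (K := K) (n := n)
  have hθ := QKlyachko.single_finRotate_mul_theta (K := K) (n := n)
  rw [QKlyachko.coe_ideal_span_eq he, QKlyachko.coe_ideal_span_eq hθ]
  have hLe : QKlyachko.lieElements K n ≤ Submodule.span (QKlyachko.RatField K n)
      (Set.range fun σ : {σ : Equiv.Perm (Fin n) // σ 0 = 0} =>
        (SkewMonoidAlgebra.single σ.1 1 * QKlyachko.e K n : QKlyachko.TwistedAlg K n)) := by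
    intro x hx
    rw [← QKlyachko.mul_e_of_mem_lieElements hx]
    exact QKlyachko.mul_mem_span he x
  have hfact := QKlyachko.factorial_le_finrank_lieElements (K := K) (n := n)
  -- The larger space has dimension at most `(n-1)!`, the smaller at least `(n-1)!`.
  have hL := Submodule.eq_of_le_of_finrank_le hLe ((QKlyachko.finrank_span_le _).trans hfact)
  have hdim : Module.finrank (QKlyachko.RatField K n) (QKlyachko.lieElements K n) =
      (n - 1).factorial := by
    refine le_antisymm ?_ hfact
    rw [hL]
    exact QKlyachko.finrank_span_le _
  rw [← hL]
  set W := Submodule.span (QKlyachko.RatField K n)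
      (Set.range fun σ : {σ : Equiv.Perm (Fin n) // σ 0 = 0} =>
        (SkewMonoidAlgebra.single σ.1 1 * QKlyachko.theta K n : QKlyachko.TwistedAlg K n)) with hW
  have hleft : Set.LeftInvOn (fun y : QKlyachko.TwistedAlg K n => y * QKlyachko.e K n)
      (fun x : QKlyachko.TwistedAlg K n => x * QKlyachko.theta K n)
      (QKlyachko.lieElements K n) := by
    intro x hx
    change x * QKlyachko.theta K n * QKlyachko.e K n = x
    -- `θ ⋉ e = e`, and `e` is a right identity on Lie elements.
    rw [mul_assoc, QKlyachko.theta_mul he, QKlyachko.mul_e_of_mem_lieElements hx]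
  let f : QKlyachko.lieElements K n →ₗ[QKlyachko.RatField K n] QKlyachko.TwistedAlg K n :=
    QKlyachko.mulRightMap (QKlyachko.theta K n) ∘ₗ (QKlyachko.lieElements K n).subtype
  have hinj : Function.Injective f := fun x y h => Subtype.ext (hleft.injOn x.2 y.2 h)
  have hrange : LinearMap.range f ≤ W := by
    rintro _ ⟨x, rfl⟩
    exact QKlyachko.mul_mem_span hθ x.1
  have hfr : Module.finrank (QKlyachko.RatField K n) (LinearMap.range f) = (n - 1).factorial := by
    rw [LinearMap.finrank_range_of_inj hinj, hdim]
  have hrangeW := Submodule.eq_of_le_of_finrank_le hrange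
    ((QKlyachko.finrank_span_le _).trans hfr.ge)
  have hbij : Set.BijOn (fun x : QKlyachko.TwistedAlg K n => x * QKlyachko.theta K n)
      (QKlyachko.lieElements K n) W := by
    refine ⟨fun x hx => QKlyachko.mul_mem_span hθ x, hleft.injOn, ?_⟩
    intro y hy
    obtain ⟨x, rfl⟩ : y ∈ LinearMap.range f := hrangeW ▸ hy
    exact ⟨x.1, x.2, rfl⟩
  refine ⟨rfl, hdim, hbij, ⟨hleft, ?_⟩, ?_, rfl⟩
  · intro y hy
    obtain ⟨x, hx, rfl⟩ := hbij.surjOn hy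
    exact congrArg (fun x : QKlyachko.TwistedAlg K n => x * QKlyachko.theta K n) (hleft hx)
  -- The family has `(n-1)!` members and spans a space of that dimension.
  · rw [linearIndependent_iff_card_eq_finrank_span, QKlyachko.card_perm_fix_zero, ← hfr, hrangeW]
    rfl
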